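/- Let $f:[0,\infty)\to\mathbb{R}$ be a standard operator monotone function: $0\le A\le B$ implies $f(A)\le f(B)$ for Hermitian matrices $A,B$ of any size, $f(x)=x f(1/x)$ for $x>0$, $f(1)=1$, and $f(0)=\lim_{x\to0^+}f(x)$. Let $c_f(x,y)=[y f(x y^{-1})]^{-1}$, extended to the edge $y=0$, $x>0$, by continuity, $c_f(x,0)=[x f(0)]^{-1}$. For a state (density matrix) $\rho$ and an observable (Hermitian matrix) $H$ on a finite-dimensional quantum system, the skew information associated with $f$ is $$I^f(\rho,H)=\frac{f(0)}{2}\operatorname{Tr}\big[(i[H,\rho])\,c_f(L_\rho,R_\rho)(i[H,\rho])\big],\qquad L_\rho X=\rho X,\quad R_\rho X=X\rho$$ (with $I^f=0$ if $f(0)=0$), and the Wigner–Yanase skew information is $I^{WY}(\rho,H)=-\tfrac12\operatorname{Tr}([\sqrt\rho,H]^2)$. Let $M(\cdot)=\sum_j E_j\cdot E_j^\dagger$ be a measurement with finitely many outcomes, $\sum_j E_j^\dagger E_j=\mathbb{I}$, such that $[E_j,H]=0$ for all $j$. Put $p_j=\operatorname{Tr}[E_j\rho E_j^\dagger]$ and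 $\sigma_j=E_j\rho E_j^\dagger/p_j$ (outcomes with $p_j=0$ contribute $0$ to the sums below). Then, in any finite dimension, for every such $f$ and every state $\rho$, $$I^f(M(\rho),H)\le I^f(\rho,H)\qquad\text{and}\qquad \sum_j p_j\,I^f(\sigma_j,H)\le I^f(\rho,H).$$ In particular, in any finite dimension, $$I^{WY}(M(\rho),H)\le I^{WY}(\rho,H)\qquad\text{and}\qquad \sum_j p_j\,I^{WY}(\sigma_j,H)\le I^{WY}(\rho,H),$$ the last inequality being Luo's conjecture. -/

import Mathlib

open scoped Matrix ComplexOrder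

namespace SkewInformation

/-- `f`, viewed as a function on `[0, ∞)`, is a standard (symmetric, normalized) operator monotone
function. Since the spectrum of a Hermitian matrix is finite, `cfc f A` is the usual `f(A)` for every
`f`. The value `f 0` is the limit of `f` at `0` from the right. -/
structure IsStandardOperatorMonotone (f : ℝ → ℝ) : Prop where
  /-- `0 ≤ A ≤ B` implies `f(A) ≤ f(B)`, for Hermitian matrices of every size. -/
  operator_monotone : ∀ (k : ℕ) (A B : Matrix (Fin k) (Fin k) ℂ),
    A.PosSemidef → (B - A).PosSemidef → (cfc f B - cfc f A).PosSemidef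
  symmetric : ∀ x : ℝ, 0 < x → f x = x * f (1 / x)
  normalized : f 1 = 1
  continuous_zero : ContinuousWithinAt f (Set.Ici 0) 0

/-- The Morozova-Chentsov function `c_f(x, y) = [y f(x y⁻¹)]⁻¹`, for `x, y ≥ 0`. On the edge `y = 0`
it is the continuous (equivalently, the symmetric) extension `c_f(x, 0) = [x f(0)]⁻¹`. -/
noncomputable def morozovaChentsov (f : ℝ → ℝ) (x y : ℝ) : ℝ :=
  if y = 0 then (x * f 0)⁻¹ else (y * f (x * y⁻¹))⁻¹

section

variable {n : Type*} [Fintype n] [DecidableEq n]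

/-- The spectral projection of a Hermitian matrix `ρ` onto its eigenspace for the number `a`. -/
noncomputable def spectralProjection (ρ : Matrix n n ℂ) (a : ℝ) : Matrix n n ℂ :=
  cfc (fun x : ℝ => if x = a then (1 : ℝ) else 0) ρ

/-- The superoperator `g(L_ρ, R_ρ)` for Hermitian `ρ`: joint functional calculus of the commuting
operators `L_ρ X = ρ X` and `R_ρ X = X ρ`, whose joint spectral projections are
`X ↦ P_a X P_b`, with `a, b` in the spectrum of `ρ`. -/
noncomputable def leftRightCalculus (g : ℝ → ℝ → ℝ) (ρ X : Matrix n n ℂ) : Matrix n n ℂ :=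
  ∑ a ∈ (Matrix.finite_real_spectrum (A := ρ)).toFinset,
    ∑ b ∈ (Matrix.finite_real_spectrum (A := ρ)).toFinset,
      g a b • (spectralProjection ρ a * X * spectralProjection ρ b)

/-- The metric-adjusted skew information
`I^f(ρ, H) = (f(0) / 2) Tr[(i[H, ρ]) c_f(L_ρ, R_ρ)(i[H, ρ])]` (the trace is a real number). -/
noncomputable def skewInformation (f : ℝ → ℝ) (ρ H : Matrix n n ℂ) : ℝ :=
  f 0 / 2 * (Matrix.trace ((Complex.I • ⁅H, ρ⁆) *
    leftRightCalculus (morozovaChentsov f) ρ (Complex.I • ⁅H, ρ⁆))).re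

/-- The Wigner-Yanase skew information `I^{WY}(ρ, H) = -(1/2) Tr([√ρ, H]²)` (the trace is a real
number). -/
noncomputable def wignerYanase (ρ H : Matrix n n ℂ) : ℝ :=
  -(1 / 2) * (Matrix.trace (⁅cfc Real.sqrt ρ, H⁆ ^ 2)).re

/-- Quantum states: positive semidefinite matrices of trace one. -/
def IsState (ρ : Matrix n n ℂ) : Prop :=
  ρ.PosSemidef ∧ ρ.trace = 1

variable {J : Type*} [Fintype J]

/-- `E` is the family of operators of a measurement: `∑ⱼ Eⱼ† Eⱼ = 1`. -/
def IsMeasurement (E : J → Matrix n n ℂ) : Prop :=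
  ∑ j, (E j)ᴴ * E j = 1

/-- The measurement operation `M(ρ) = ∑ⱼ Eⱼ ρ Eⱼ†`. -/
def measure (E : J → Matrix n n ℂ) (ρ : Matrix n n ℂ) : Matrix n n ℂ :=
  ∑ j, E j * ρ * (E j)ᴴ

/-- The probability `pⱼ = Tr[Eⱼ ρ Eⱼ†]` of the outcome with operator `Eⱼ = K`. -/
noncomputable def outcomeProb (K ρ : Matrix n n ℂ) : ℝ :=
  (Matrix.trace (K * ρ * Kᴴ)).re

/-- The state `σⱼ = Eⱼ ρ Eⱼ† / pⱼ` after the outcome with operator `Eⱼ = K` (the zero matrix if the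
outcome has probability zero). -/
noncomputable def outcomeState (K ρ : Matrix n n ℂ) : Matrix n n ℂ :=
  (outcomeProb K ρ)⁻¹ • (K * ρ * Kᴴ)

end

end SkewInformation

/-!
The idea is Petz's monotonicity theorem for monotone metrics, in a form that works with diagonal
matrices only and reaches singular states directly.

Write `m_f(x, y) = y f(x / y)` for the operator mean of `f` (`perspective`), the reciprocal of the
Morozova-Chentsov function `c_f`. In an eigenbasis of `ρ` the commuting operators `L_ρ` and `R_ρ` on
matrices are diagonal, and `I^f(ρ, H)` is `f(0) / 2` times the sum of `c_f(λᵢ, λⱼ) |Xᵢⱼ|²`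
with `X = i[H, ρ]` (`skewInformation_unitary_conj`).

*Monotonicity of the mean.* Let `Tᴴ A T ≤ A'` and `Tᴴ B T ≤ B'` for diagonal positive matrices. Then
`W = B^(1/2) T B'^(-1/2)` is a contraction with `Wᴴ (A / B) W ≤ A' / B'`, and Hansen's inequality
gives `Wᴴ f(A / B) W ≤ f(A' / B')`, that is `Tᴴ m_f(A, B) T ≤ m_f(A', B')`. Hansen's inequality
itself follows from operator monotonicity, after dilating `W` to an isometry and bounding `A` by its
two diagonal corners (`posSemidef_block_bound`). The passage to semidefinite matrices is a limit of
scalar functions (`sum_perspective_le`): the symmetry `f(x) = x f(1 / x)` makes `f` continuous, and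
`m_f` continuous along regularizations up to the boundary of the quadrant.

*Application to a measurement.* For `T` take the dual `Y ↦ ∑ⱼ Eⱼᴴ Y_{κ j} Eⱼ` of a measurement of
which only the class `κ j` of the outcome is recorded. The two hypotheses on `T`, for `L_ρ` and for
`R_ρ`, are instances of a Kadison-Schwarz inequality (`IsMeasurement.re_trace_le`). Since the
measurement commutes with `H`, it maps `i[H, ρ]` to `i[H, M(ρ)]`, and the variational formula
`c |x|² = max_z (2 Re (x̄ z) - c⁻¹ |z|²)` turns the inequality for `m_f` into the one for `c_f`
(`IsStandardOperatorMonotone.sum_skewInformation_coarseOutput_le`). A constant `κ` gives the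
inequality for `M(ρ)`; the identity gives the one for the outcome states, whose normalization is
absorbed by the homogeneity of `I^f`.

The Wigner-Yanase information is the case `f(x) = ((1 + √x) / 2)²`.
-/

namespace SkewInformation

open Polynomial Filter Topology

/-! ### Functional calculus of Hermitian matrices through eigenvectors -/

section FunctionalCalculus

variable {m n : Type*} [Fintype m] [DecidableEq m] [Fintype n] [DecidableEq n]

/-- The real diagonal matrix with entries `d`, as a complex matrix. -/
noncomputable abbrev realDiagonal (d : n → ℝ) : Matrix n n ℂ :=
  Matrix.diagonal fun i => (d i : ℂ)

omit [Fintype n] in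
lemma isHermitian_realDiagonal (d : n → ℝ) : (realDiagonal d).IsHermitian := by
  ext i j
  rcases eq_or_ne i j with rfl | h
  · simp
  · simp [h, h.symm]

lemma aeval_mul_eq_mul_realDiagonal {B : Matrix m m ℂ} {V : Matrix m n ℂ} {d : n → ℝ}
    (h : B * V = V * realDiagonal d) (q : ℝ[X]) :
    aeval B q * V = V * realDiagonal fun i => q.eval (d i) := by
  induction q using Polynomial.induction_on' with
  | add p q hp hq =>
    rw [map_add, Matrix.add_mul, hp, hq, ← Matrix.mul_add, Matrix.diagonal_add]
    simp [realDiagonal]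
  | monomial k a =>
    have hk : B ^ k * V = V * realDiagonal fun i => d i ^ k := by
      induction k with
      | zero => simp [realDiagonal]
      | succ k ih =>
        rw [pow_succ, Matrix.mul_assoc, h, ← Matrix.mul_assoc, ih, Matrix.mul_assoc,
          Matrix.diagonal_mul_diagonal]
        simp [pow_succ, realDiagonal]
    rw [aeval_monomial, Algebra.algebraMap_eq_smul_one, smul_mul_assoc, one_mul, Matrix.smul_mul, hk,
      ← Matrix.mul_smul]
    congr 1
    ext i j
    rcases eq_or_ne i j with rfl | hij
    · simp
    · simp [hij]

/-- If the columns of `V` are eigenvectors of `B`, then they are eigenvectors of `f(B)`. -/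
lemma cfc_mul_eq_mul_realDiagonal (f : ℝ → ℝ) {B : Matrix m m ℂ} (hB : B.IsHermitian)
    {V : Matrix m n ℂ} {d : n → ℝ} (h : B * V = V * realDiagonal d) :
    cfc f B * V = V * realDiagonal fun i => f (d i) := by
  set S : Finset ℝ := (Matrix.finite_real_spectrum (A := B)).toFinset ∪ Finset.univ.image d
  -- On the finite set `S` the function `f` agrees with its Lagrange interpolation polynomial.
  set q : ℝ[X] := Lagrange.interpolate S id f
  have hq : ∀ x ∈ S, q.eval x = f x := fun x hx =>
    Lagrange.eval_interpolate_at_node (s := S) (v := id) f (Set.injOn_id _) hx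
  have h1 : cfc f B = aeval B q := by
    rw [← cfc_polynomial q B hB]
    refine cfc_congr fun x hx => (hq x ?_).symm
    simp [S, hx]
  rw [h1, aeval_mul_eq_mul_realDiagonal h]
  congr 2
  ext i
  rw [hq]
  simp [S]

lemma cfc_realDiagonal (f : ℝ → ℝ) (d : n → ℝ) :
    cfc f (realDiagonal d) = realDiagonal fun i => f (d i) := by
  simpa using cfc_mul_eq_mul_realDiagonal f (isHermitian_realDiagonal d) (V := 1) (d := d) (by simp)

lemma isHermitian_unitary_conj (U : Matrix n n ℂ) (d : n → ℝ) :
    (U * realDiagonal d * Uᴴ).IsHermitian :=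
  Matrix.isHermitian_mul_mul_conjTranspose U (isHermitian_realDiagonal d)

lemma cfc_unitary_conj (f : ℝ → ℝ) {U : Matrix n n ℂ} (hU : Uᴴ * U = 1) (d : n → ℝ) :
    cfc f (U * realDiagonal d * Uᴴ) = U * realDiagonal (fun i => f (d i)) * Uᴴ := by
  have h := cfc_mul_eq_mul_realDiagonal f (isHermitian_unitary_conj U d) (V := U) (d := d)
    (by rw [Matrix.mul_assoc, hU, Matrix.mul_one])
  rw [← h, Matrix.mul_assoc (cfc f _), mul_eq_one_comm.mp hU, Matrix.mul_one]

/-- The spectral theorem, with the eigenvalues of a positive semidefinite matrix. -/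
lemma exists_unitary_conj {A : Matrix n n ℂ} (hA : A.PosSemidef) :
    ∃ (U : Matrix n n ℂ) (d : n → ℝ), Uᴴ * U = 1 ∧ (∀ i, 0 ≤ d i) ∧
      A = U * realDiagonal d * Uᴴ := by
  refine ⟨hA.1.eigenvectorUnitary, hA.1.eigenvalues, ?_, hA.eigenvalues_nonneg, ?_⟩
  · simpa [Matrix.star_eq_conjTranspose] using Unitary.coe_star_mul_self hA.1.eigenvectorUnitary
  · conv_lhs => rw [hA.1.spectral_theorem]
    simp only [Unitary.conjStarAlgAut_apply]
    rfl

lemma cfc_reindex (f : ℝ → ℝ) (e : m ≃ n) {A : Matrix m m ℂ} (hA : A.IsHermitian) :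
    cfc f (Matrix.reindex e e A) = Matrix.reindex e e (cfc f A) := by
  have hA' : (Matrix.reindex e e A).IsHermitian := hA.submatrix _
  set S : Finset ℝ := (Matrix.finite_real_spectrum (A := A)).toFinset ∪
    (Matrix.finite_real_spectrum (A := Matrix.reindex e e A)).toFinset
  set q : ℝ[X] := Lagrange.interpolate S id f
  have hq : ∀ x ∈ S, q.eval x = f x := fun x hx =>
    Lagrange.eval_interpolate_at_node (s := S) (v := id) f (Set.injOn_id _) hx
  have h1 : cfc f A = aeval A q := by
    rw [← cfc_polynomial q A hA]
    exact cfc_congr fun x hx => (hq x (by simp [S, hx])).symm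
  have h2 : cfc f (Matrix.reindex e e A) = aeval (Matrix.reindex e e A) q := by
    rw [← cfc_polynomial q _ hA']
    refine cfc_congr fun x hx => (hq x ?_).symm
    simp only [S, Finset.mem_union, Set.Finite.mem_toFinset]
    exact Or.inr hx
  rw [h1, h2]
  exact aeval_algHom_apply (Matrix.reindexAlgEquiv ℝ ℂ e : Matrix m m ℂ →ₐ[ℝ] Matrix n n ℂ) A q

/-- Operator monotonicity, for matrices over an arbitrary finite index type. -/
lemma IsStandardOperatorMonotone.cfc_sub_posSemidef {f : ℝ → ℝ}
    (hf : IsStandardOperatorMonotone f) {A B : Matrix n n ℂ} (hA : A.PosSemidef)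
    (hAB : (B - A).PosSemidef) : (cfc f B - cfc f A).PosSemidef := by
  have hB : B.PosSemidef := by simpa using hAB.add hA
  let e := Fintype.equivFin n
  have h := hf.operator_monotone _ (Matrix.reindex e e A) (Matrix.reindex e e B)
    (hA.submatrix _) (hAB.submatrix _)
  rw [cfc_reindex f e hA.1, cfc_reindex f e hB.1] at h
  have h' := h.submatrix e
  rw [Matrix.submatrix_sub] at h'
  simpa [Pi.sub_def] using h'

end FunctionalCalculus

/-! ### Standard operator monotone functions and their means on the half-line -/

section Scalar

namespace IsStandardOperatorMonotone

variable {f : ℝ → ℝ} (hf : IsStandardOperatorMonotone f)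
include hf

lemma monotoneOn : MonotoneOn f (Set.Ici 0) := by
  intro x hx y hy hxy
  have h := hf.cfc_sub_posSemidef (n := Unit) (A := realDiagonal fun _ => x)
    (B := realDiagonal fun _ => y)
    (Matrix.PosSemidef.diagonal fun _ => by simpa using hx)
    (by rw [Matrix.diagonal_sub]; exact Matrix.PosSemidef.diagonal fun _ => by
          simpa [← Complex.ofReal_sub] using hxy)
  rw [cfc_realDiagonal, cfc_realDiagonal, Matrix.diagonal_sub,
    Matrix.posSemidef_diagonal_iff] at h
  simpa using h ()

lemma pos {x : ℝ} (hx : 0 < x) : 0 < f x := by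
  rcases le_total 1 x with h | h
  · have := hf.monotoneOn (Set.mem_Ici.2 zero_le_one) (Set.mem_Ici.2 hx.le) h
    rw [hf.normalized] at this
    linarith
  · have := hf.monotoneOn (Set.mem_Ici.2 zero_le_one) (Set.mem_Ici.2 (by positivity))
      ((one_le_div hx).2 h)
    rw [hf.normalized] at this
    rw [hf.symmetric x hx]
    exact mul_pos hx (by linarith)

lemma nonneg_zero : 0 ≤ f 0 := by
  have h : Tendsto f (𝓝[>] 0) (𝓝 (f 0)) :=
    hf.continuous_zero.mono_left (nhdsWithin_mono _ Set.Ioi_subset_Ici_self)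
  exact ge_of_tendsto h (eventually_mem_nhdsWithin.mono fun x hx => (hf.pos hx).le)

/-- By the symmetry of `f`, the function `x ↦ f x / x` is decreasing. -/
lemma mul_le_mul_of_le {x y : ℝ} (hx : 0 < x) (hxy : x ≤ y) : x * f y ≤ y * f x := by
  have hy := hx.trans_le hxy
  have h := hf.monotoneOn (Set.mem_Ici.2 (by positivity)) (Set.mem_Ici.2 (by positivity))
    (one_div_le_one_div_of_le hx hxy)
  rw [hf.symmetric x hx, hf.symmetric y hy]
  nlinarith [mul_le_mul_of_nonneg_left h (mul_pos hx hy).le]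

lemma continuousOn : ContinuousOn f (Set.Ici 0) := by
  intro x hx
  rcases (Set.mem_Ici.1 hx).eq_or_lt with rfl | hx
  · exact hf.continuous_zero
  -- Monotonicity of `f` and antitonicity of `f x / x` squeeze `f y` as `y → x`.
  refine ContinuousAt.continuousWithinAt ?_
  have hlo : Tendsto (fun y => min (f x) (y / x * f x)) (𝓝 x) (𝓝 (f x)) := by
    have : ContinuousAt (fun y => min (f x) (y / x * f x)) x := by fun_prop
    simpa [ContinuousAt, hx.ne'] using this
  have hhi : Tendsto (fun y => max (f x) (y / x * f x)) (𝓝 x) (𝓝 (f x)) := by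
    have : ContinuousAt (fun y => max (f x) (y / x * f x)) x := by fun_prop
    simpa [ContinuousAt, hx.ne'] using this
  refine tendsto_of_tendsto_of_tendsto_of_le_of_le' hlo hhi ?_ ?_
  · filter_upwards [lt_mem_nhds hx] with y hy
    rcases le_total x y with h | h
    · exact min_le_of_left_le (hf.monotoneOn (Set.mem_Ici.2 hx.le) (Set.mem_Ici.2 hy.le) h)
    · refine min_le_of_right_le ?_
      rw [div_mul_eq_mul_div, div_le_iff₀ hx]
      linarith [hf.mul_le_mul_of_le hy h]
  · filter_upwards [lt_mem_nhds hx] with y hy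
    rcases le_total x y with h | h
    · refine le_max_of_le_right ?_
      rw [div_mul_eq_mul_div, le_div_iff₀ hx]
      linarith [hf.mul_le_mul_of_le hx h]
    · exact le_max_of_le_left (hf.monotoneOn (Set.mem_Ici.2 hy.le) (Set.mem_Ici.2 hx.le) h)

end IsStandardOperatorMonotone

/-- The perspective `m_f(x, y) = y f(x / y)` of `f`, which is the operator mean associated with `f`,
extended continuously to `y = 0`; it is the reciprocal of the Morozova-Chentsov function. -/
noncomputable def perspective (f : ℝ → ℝ) (x y : ℝ) : ℝ :=
  (morozovaChentsov f x y)⁻¹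

lemma perspective_of_ne_zero (f : ℝ → ℝ) (x : ℝ) {y : ℝ} (hy : y ≠ 0) :
    perspective f x y = y * f (x / y) := by
  simp [perspective, morozovaChentsov, hy, div_eq_mul_inv]

lemma perspective_zero (f : ℝ → ℝ) (x : ℝ) : perspective f x 0 = x * f 0 := by
  simp [perspective, morozovaChentsov]

namespace IsStandardOperatorMonotone

variable {f : ℝ → ℝ} (hf : IsStandardOperatorMonotone f)
include hf

lemma perspective_comm {x y : ℝ} (hx : 0 < x) (hy : 0 < y) :
    perspective f x y = perspective f y x := by
  rw [perspective_of_ne_zero f x hy.ne', perspective_of_ne_zero f y hx.ne',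
    hf.symmetric _ (div_pos hx hy), one_div_div]
  field_simp

/-- Continuity of the mean under a regularization of both arguments, up to the boundary. -/
lemma tendsto_perspective {x y c : ℝ} (hx : 0 ≤ x) (hy : 0 ≤ y) (hc : 0 < c) :
    Tendsto (fun ε => perspective f (x + c * ε) (y + c * ε)) (𝓝[>] 0) (𝓝 (perspective f x y)) := by
  -- The case in which the denominator stays away from zero.
  have key : ∀ {x y : ℝ}, 0 ≤ x → 0 < y →
      Tendsto (fun ε => (y + c * ε) * f ((x + c * ε) / (y + c * ε))) (𝓝[>] 0)
        (𝓝 (y * f (x / y))) := by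
    intro x y hx hy
    have h1 : Tendsto (fun ε => y + c * ε) (𝓝[>] 0) (𝓝 y) := by
      have : ContinuousAt (fun ε => y + c * ε) 0 := by fun_prop
      simpa using this.tendsto.mono_left nhdsWithin_le_nhds
    have h2 : Tendsto (fun ε => x + c * ε) (𝓝[>] 0) (𝓝 x) := by
      have : ContinuousAt (fun ε => x + c * ε) 0 := by fun_prop
      simpa using this.tendsto.mono_left nhdsWithin_le_nhds
    refine h1.mul (((hf.continuousOn _ (Set.mem_Ici.2 (by positivity))).tendsto).comp
      (tendsto_nhdsWithin_iff.2 ⟨h2.div h1 hy.ne', ?_⟩))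
    filter_upwards [self_mem_nhdsWithin] with ε hε
    have : 0 < ε := hε
    exact Set.mem_Ici.2 (by positivity)
  rcases hy.eq_or_lt with rfl | hy
  · rcases hx.eq_or_lt with rfl | hx
    · rw [perspective_zero, zero_mul]
      have h : Tendsto (fun ε : ℝ => c * ε) (𝓝[>] 0) (𝓝 0) := by
        have : ContinuousAt (fun ε : ℝ => c * ε) 0 := by fun_prop
        simpa using this.tendsto.mono_left nhdsWithin_le_nhds
      refine h.congr' ?_
      filter_upwards [self_mem_nhdsWithin] with ε hε
      have hε : 0 < c * ε := mul_pos hc hε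
      rw [zero_add, perspective_of_ne_zero f _ hε.ne', div_self hε.ne', hf.normalized, mul_one]
    · rw [perspective_zero]
      have h := key le_rfl hx
      rw [zero_div] at h
      refine h.congr' ?_
      filter_upwards [self_mem_nhdsWithin] with ε hε
      have hε : 0 < c * ε := mul_pos hc hε
      have hx' : 0 < x + c * ε := by positivity
      rw [hf.perspective_comm hx' (by linarith), perspective_of_ne_zero f _ hx'.ne']
  · rw [perspective_of_ne_zero f x hy.ne']
    refine (key hx hy).congr' ?_
    filter_upwards [self_mem_nhdsWithin] with ε hε
    have hε : 0 < c * ε := mul_pos hc hε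
    rw [perspective_of_ne_zero f _ (by positivity)]

end IsStandardOperatorMonotone

end Scalar

/-! ### Hansen's inequality and the transformer inequality for operator means -/

section QuadraticForms

variable {p q : Type*} [Fintype p] [DecidableEq p] [Fintype q] [DecidableEq q]

lemma star_dotProduct_realDiagonal_mulVec (d : p → ℝ) (x : p → ℂ) :
    star x ⬝ᵥ (realDiagonal d *ᵥ x) = ((∑ i, d i * ‖x i‖ ^ 2 : ℝ) : ℂ) := by
  simp only [dotProduct, Matrix.mulVec_diagonal, Pi.star_apply, Complex.ofReal_sum]
  refine Finset.sum_congr rfl fun i _ => ?_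
  rw [Complex.ofReal_mul, Complex.ofReal_pow, ← Complex.conj_mul']
  simp only [RCLike.star_def]
  ring

omit [DecidableEq p] [DecidableEq q] in
lemma star_dotProduct_conj_mulVec (T : Matrix p q ℂ) (A : Matrix p p ℂ) (y : q → ℂ) :
    star y ⬝ᵥ ((Tᴴ * A * T) *ᵥ y) = star (T *ᵥ y) ⬝ᵥ (A *ᵥ (T *ᵥ y)) := by
  rw [← Matrix.mulVec_mulVec, ← Matrix.mulVec_mulVec, Matrix.dotProduct_mulVec,
    Matrix.star_mulVec]

/-- The operator inequality `Tᴴ diag(a) T ≤ diag(b)`, in terms of quadratic forms. -/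
lemma posSemidef_realDiagonal_sub_iff (T : Matrix p q ℂ) (a : p → ℝ) (b : q → ℝ) :
    (realDiagonal b - Tᴴ * realDiagonal a * T).PosSemidef ↔
      ∀ y : q → ℂ, ∑ i, a i * ‖(T *ᵥ y) i‖ ^ 2 ≤ ∑ j, b j * ‖y j‖ ^ 2 := by
  have key : ∀ y : q → ℂ, star y ⬝ᵥ ((realDiagonal b - Tᴴ * realDiagonal a * T) *ᵥ y) =
      ((∑ j, b j * ‖y j‖ ^ 2 - ∑ i, a i * ‖(T *ᵥ y) i‖ ^ 2 : ℝ) : ℂ) := fun y => by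
    rw [Matrix.sub_mulVec, dotProduct_sub, star_dotProduct_conj_mulVec,
      star_dotProduct_realDiagonal_mulVec, star_dotProduct_realDiagonal_mulVec,
      Complex.ofReal_sub]
  have hherm : (realDiagonal b - Tᴴ * realDiagonal a * T).IsHermitian :=
    (isHermitian_realDiagonal b).sub
      (Matrix.isHermitian_conjTranspose_mul_mul T (isHermitian_realDiagonal a))
  rw [Matrix.posSemidef_iff_dotProduct_mulVec, and_iff_right hherm]
  refine forall_congr' fun y => ?_
  rw [key y, Complex.zero_le_real, sub_nonneg]

/-- An upper bound for a compression: if `P = V Vᴴ` is the range projection of an isometry `V` and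
`Q = 1 - P`, then `A ≤ (1 + s²) P A P + (1 + s⁻²) Q A Q`, so that bounds on the two diagonal corners
of `A` bound `A` itself, up to a factor that is arbitrarily close to `1` on the first corner. -/
lemma posSemidef_block_bound {V : Matrix p q ℂ} (hV : Vᴴ * V = 1) {A : Matrix p p ℂ}
    (hA : A.PosSemidef) {b : q → ℝ} (hb : (realDiagonal b - Vᴴ * A * V).PosSemidef)
    {M : ℝ} (hM : ((M • 1 : Matrix p p ℂ) - A).PosSemidef) {s : ℝ} (hs : 0 < s) :
    (V * ((1 + s ^ 2) • realDiagonal b) * Vᴴ + ((1 + (s ^ 2)⁻¹) * M) • (1 - V * Vᴴ) -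
      A).PosSemidef := by
  set P := V * Vᴴ with hP
  have hPP : P * P = P := by
    rw [hP, Matrix.mul_assoc, ← Matrix.mul_assoc Vᴴ, hV, Matrix.one_mul]
  have hPh : Pᴴ = P := by simp [hP]
  set S : Matrix p p ℂ := s • P - s⁻¹ • (1 - P) with hS
  have hSh : Sᴴ = S := by
    simp [hS, hPh, Matrix.conjTranspose_sub, Matrix.conjTranspose_smul]
  have hQh : (1 - P)ᴴ = 1 - P := by simp [hPh]
  have h1 := ((hb.mul_mul_conjTranspose_same V).smul (a := 1 + s ^ 2) (by positivity)).add
    ((hA.mul_mul_conjTranspose_same S).add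
    ((hM.mul_mul_conjTranspose_same (1 - P)).smul (a := 1 + (s ^ 2)⁻¹) (by positivity)))
  convert h1 using 1
  rw [hSh, hQh]
  have e1 : V * (realDiagonal b - Vᴴ * A * V) * Vᴴ = V * realDiagonal b * Vᴴ - P * A * P := by
    rw [Matrix.mul_sub, Matrix.sub_mul, hP]
    simp only [Matrix.mul_assoc]
  have e2 : (1 - P) * (M • 1 - A) * (1 - P) =
      M • (1 - P) - (A - P * A - A * P + P * A * P) := by
    simp only [Matrix.mul_sub, Matrix.sub_mul, Matrix.one_mul, Matrix.mul_one, Matrix.smul_mul,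
      Matrix.mul_smul, hPP]
    module
  have e3 : S * A * S = (s + s⁻¹) ^ 2 • (P * A * P) -
      ((s + s⁻¹) * s⁻¹) • (P * A + A * P) + (s⁻¹ ^ 2) • A := by
    have : S = (s + s⁻¹) • P - s⁻¹ • (1 : Matrix p p ℂ) := by rw [hS]; module
    rw [this]
    simp only [Matrix.mul_sub, Matrix.sub_mul, Matrix.one_mul, Matrix.mul_one, Matrix.smul_mul,
      Matrix.mul_smul]
    module
  rw [e1, e2, e3, Matrix.mul_smul, Matrix.smul_mul]
  match_scalars <;> field_simp <;> ring

namespace IsStandardOperatorMonotone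

variable {f : ℝ → ℝ} (hf : IsStandardOperatorMonotone f)
include hf

/-- Jensen's operator inequality for an isometry `V` and a diagonal matrix. -/
lemma sum_le_sum_of_isometry {V : Matrix p q ℂ} (hV : Vᴴ * V = 1) {a : p → ℝ} (ha : ∀ i, 0 ≤ a i)
    {b : q → ℝ} (hb : ∀ j, 0 ≤ b j)
    (h : ∀ y : q → ℂ, ∑ i, a i * ‖(V *ᵥ y) i‖ ^ 2 ≤ ∑ j, b j * ‖y j‖ ^ 2) (y : q → ℂ) :
    ∑ i, f (a i) * ‖(V *ᵥ y) i‖ ^ 2 ≤ ∑ j, f (b j) * ‖y j‖ ^ 2 := by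
  have hA : (realDiagonal a).PosSemidef :=
    Matrix.PosSemidef.diagonal fun i => by simpa using ha i
  have hM : (((∑ i, a i) • 1 : Matrix p p ℂ) - realDiagonal a).PosSemidef := by
    have : ((∑ i, a i) • 1 : Matrix p p ℂ) = realDiagonal fun _ => ∑ i, a i := by
      ext i j
      simp [Matrix.one_apply, Matrix.diagonal_apply]
    rw [this, Matrix.diagonal_sub]
    refine Matrix.PosSemidef.diagonal fun i => ?_
    rw [Pi.zero_apply, sub_nonneg]
    exact Complex.real_le_real.2 <| Finset.single_le_sum (fun j _ => ha j) (Finset.mem_univ i)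
  have hs : ∀ s : ℝ, 0 < s →
      ∑ i, f (a i) * ‖(V *ᵥ y) i‖ ^ 2 ≤ ∑ j, f ((1 + s ^ 2) * b j) * ‖y j‖ ^ 2 := by
    intro s hs
    have hB := posSemidef_block_bound hV hA ((posSemidef_realDiagonal_sub_iff V a b).2 h) hM hs
    set B := V * ((1 + s ^ 2) • realDiagonal b) * Vᴴ +
      ((1 + (s ^ 2)⁻¹) * ∑ i, a i) • (1 - V * Vᴴ) with hBdef
    have hBh : B.IsHermitian := by simpa using (hB.add hA).1
    have hBV : B * V = V * realDiagonal fun j => (1 + s ^ 2) * b j := by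
      have : (1 - V * Vᴴ) * V = 0 := by
        rw [Matrix.sub_mul, Matrix.mul_assoc, hV, Matrix.one_mul, Matrix.mul_one, sub_self]
      rw [hBdef, Matrix.add_mul, Matrix.smul_mul, this, smul_zero, add_zero, Matrix.mul_assoc, hV,
        Matrix.mul_one]
      congr 1
      ext i j
      rcases eq_or_ne i j with rfl | hij
      · simp
      · simp [hij]
    have hmon := (hf.cfc_sub_posSemidef hA hB).conjTranspose_mul_mul_same V
    rw [Matrix.mul_sub, Matrix.sub_mul, Matrix.mul_assoc,
      cfc_mul_eq_mul_realDiagonal f hBh hBV, ← Matrix.mul_assoc, hV, Matrix.one_mul,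
      cfc_realDiagonal] at hmon
    exact (posSemidef_realDiagonal_sub_iff V _ _).1 hmon y
  have hlim : Tendsto (fun s : ℝ => ∑ j, f ((1 + s ^ 2) * b j) * ‖y j‖ ^ 2) (𝓝[>] 0)
      (𝓝 (∑ j, f (b j) * ‖y j‖ ^ 2)) := by
    refine tendsto_finsetSum _ fun j _ => Tendsto.mul_const _ ?_
    refine ((hf.continuousOn _ (Set.mem_Ici.2 (hb j))).tendsto).comp
      (tendsto_nhdsWithin_iff.2 ⟨?_, .of_forall fun s => Set.mem_Ici.2 ?_⟩)
    · have : ContinuousAt (fun s : ℝ => (1 + s ^ 2) * b j) 0 := by fun_prop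
      simpa using this.tendsto.mono_left nhdsWithin_le_nhds
    · exact mul_nonneg (by positivity) (hb j)
  exact ge_of_tendsto hlim (eventually_mem_nhdsWithin.mono fun s h => hs s h)

/-- Hansen's inequality for a contraction `W` and a diagonal matrix, by dilating `W` to an
isometry. -/
lemma sum_le_sum_of_contraction {W : Matrix p q ℂ} {a : p → ℝ} (ha : ∀ i, 0 ≤ a i)
    {b : q → ℝ} (hb : ∀ j, 0 ≤ b j)
    (hW : ∀ y : q → ℂ, ∑ i, ‖(W *ᵥ y) i‖ ^ 2 ≤ ∑ j, ‖y j‖ ^ 2)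
    (h : ∀ y : q → ℂ, ∑ i, a i * ‖(W *ᵥ y) i‖ ^ 2 ≤ ∑ j, b j * ‖y j‖ ^ 2) (y : q → ℂ) :
    ∑ i, f (a i) * ‖(W *ᵥ y) i‖ ^ 2 ≤ ∑ j, f (b j) * ‖y j‖ ^ 2 := by
  have hdef : (1 - Wᴴ * W).PosSemidef := by
    have := (posSemidef_realDiagonal_sub_iff W (fun _ => 1) fun _ => 1).2 (by simpa using hW)
    simpa [realDiagonal] using this
  obtain ⟨U, d, -, hd, hUd⟩ := exists_unitary_conj hdef
  -- A square root `D` of the defect operator `1 - Wᴴ W` completes `W` to an isometry.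
  set D : Matrix q q ℂ := realDiagonal (fun j => √(d j)) * Uᴴ with hD
  have hDD : Dᴴ * D = 1 - Wᴴ * W := by
    rw [hUd, hD, Matrix.conjTranspose_mul, Matrix.conjTranspose_conjTranspose,
      (isHermitian_realDiagonal _).eq, Matrix.mul_assoc, ← Matrix.mul_assoc (realDiagonal _),
      Matrix.diagonal_mul_diagonal, ← Matrix.mul_assoc]
    congr 2
    ext i j
    simp only [← Complex.ofReal_mul, Real.mul_self_sqrt (hd _)]
  have hV : (Matrix.fromRows W D)ᴴ * Matrix.fromRows W D = 1 := by
    rw [Matrix.conjTranspose_fromRows_eq_fromCols_conjTranspose, Matrix.fromCols_mul_fromRows, hDD]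
    abel
  have key := hf.sum_le_sum_of_isometry hV (a := Sum.elim a fun _ => 0)
    (by rintro (i | i) <;> simp [ha]) hb
    (fun y => by simpa [Matrix.fromRows_mulVec] using h y) y
  simp only [Matrix.fromRows_mulVec, Fintype.sum_sum_type, Sum.elim_inl, Sum.elim_inr] at key
  refine le_trans (le_add_of_nonneg_right (Finset.sum_nonneg fun i _ => ?_)) key
  exact mul_nonneg hf.nonneg_zero (by positivity)

/-- The transformer inequality `Tᴴ m_f(A, B) T ≤ m_f(A', B')` for diagonal positive definite `A, B`
and `A', B'` with `Tᴴ A T ≤ A'` and `Tᴴ B T ≤ B'`: Hansen's inequality for the contraction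
`B^(1/2) T B'^(-1/2)`. -/
lemma sum_perspective_le_of_pos {T : Matrix p q ℂ} {A B : p → ℝ} {A' B' : q → ℝ}
    (hA : ∀ i, 0 < A i) (hB : ∀ i, 0 < B i) (hA' : ∀ j, 0 < A' j) (hB' : ∀ j, 0 < B' j)
    (hTA : ∀ y : q → ℂ, ∑ i, A i * ‖(T *ᵥ y) i‖ ^ 2 ≤ ∑ j, A' j * ‖y j‖ ^ 2)
    (hTB : ∀ y : q → ℂ, ∑ i, B i * ‖(T *ᵥ y) i‖ ^ 2 ≤ ∑ j, B' j * ‖y j‖ ^ 2) (y : q → ℂ) :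
    ∑ i, perspective f (A i) (B i) * ‖(T *ᵥ y) i‖ ^ 2 ≤
      ∑ j, perspective f (A' j) (B' j) * ‖y j‖ ^ 2 := by
  set W : Matrix p q ℂ := .of fun i j => (√(B i) : ℂ) * T i j * (√(B' j) : ℂ)⁻¹ with hW
  have hne : ∀ j, (√(B' j) : ℂ) ≠ 0 := fun j => by
    exact_mod_cast (Real.sqrt_pos.2 (hB' j)).ne'
  have hmul : ∀ z : q → ℂ, W *ᵥ (fun j => (√(B' j) : ℂ) * z j) =
      fun i => (√(B i) : ℂ) * (T *ᵥ z) i := fun z => by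
    ext i
    simp only [Matrix.mulVec, dotProduct, hW, Matrix.of_apply, Finset.mul_sum]
    refine Finset.sum_congr rfl fun j _ => ?_
    field_simp [hne j]
  have hsq : ∀ {t : ℝ}, 0 < t → ∀ z : ℂ, ‖(√t : ℂ) * z‖ ^ 2 = t * ‖z‖ ^ 2 := fun ht z => by
    rw [norm_mul, mul_pow, Complex.norm_real, Real.norm_eq_abs, sq_abs, Real.sq_sqrt ht.le]
  -- Every vector is `B'^(1/2) z` for some `z`.
  have hsurj : ∀ {Q : (q → ℂ) → Prop}, (∀ z : q → ℂ, Q fun j => (√(B' j) : ℂ) * z j) →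
      ∀ x, Q x := fun {Q} hQ x => by
    convert hQ fun j => (√(B' j) : ℂ)⁻¹ * x j using 2 with j
    rw [mul_inv_cancel_left₀ (hne j)]
  have key := hf.sum_le_sum_of_contraction (W := W) (a := fun i => A i / B i)
    (b := fun j => A' j / B' j) (fun i => (div_pos (hA i) (hB i)).le)
    (fun j => (div_pos (hA' j) (hB' j)).le)
    (hsurj fun z => by
      rw [hmul]
      simpa only [hsq (hB _), hsq (hB' _)] using hTB z)
    (hsurj fun z => by
      rw [hmul]
      simp only [hsq (hB _), hsq (hB' _), ← mul_assoc, div_mul_cancel₀ _ (hB _).ne',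
        div_mul_cancel₀ _ (hB' _).ne']
      exact hTA z)
    fun j => (√(B' j) : ℂ) * y j
  rw [hmul] at key
  simp only [hsq (hB _), hsq (hB' _)] at key
  simp only [perspective_of_ne_zero f _ (hB _).ne', perspective_of_ne_zero f _ (hB' _).ne']
  convert key using 2 <;> ring

/-- The transformer inequality for diagonal positive semidefinite matrices. -/
lemma sum_perspective_le {T : Matrix p q ℂ} {A B : p → ℝ} {A' B' : q → ℝ}
    (hA : ∀ i, 0 ≤ A i) (hB : ∀ i, 0 ≤ B i) (hA' : ∀ j, 0 ≤ A' j) (hB' : ∀ j, 0 ≤ B' j)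
    (hTA : ∀ y : q → ℂ, ∑ i, A i * ‖(T *ᵥ y) i‖ ^ 2 ≤ ∑ j, A' j * ‖y j‖ ^ 2)
    (hTB : ∀ y : q → ℂ, ∑ i, B i * ‖(T *ᵥ y) i‖ ^ 2 ≤ ∑ j, B' j * ‖y j‖ ^ 2) (y : q → ℂ) :
    ∑ i, perspective f (A i) (B i) * ‖(T *ᵥ y) i‖ ^ 2 ≤
      ∑ j, perspective f (A' j) (B' j) * ‖y j‖ ^ 2 := by
  set C : ℝ := ∑ i, ∑ j, ‖T i j‖ ^ 2 + 1 with hC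
  have hCpos : 0 < C := by positivity
  -- Adding `ε` to `A, B` costs at most `C ε` on the right, where `Tᴴ T ≤ C`.
  have hTC : ∀ y : q → ℂ, ∑ i, ‖(T *ᵥ y) i‖ ^ 2 ≤ C * ∑ j, ‖y j‖ ^ 2 := fun y => by
    have : ∀ i, ‖(T *ᵥ y) i‖ ^ 2 ≤ (∑ j, ‖T i j‖ ^ 2) * ∑ j, ‖y j‖ ^ 2 := fun i => by
      refine le_trans ?_ (Finset.sum_mul_sq_le_sq_mul_sq _ _ _)
      gcongr
      refine (norm_sum_le _ _).trans_eq ?_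
      simp only [norm_mul]
    refine (Finset.sum_le_sum fun i _ => this i).trans ?_
    rw [← Finset.sum_mul, hC]
    gcongr
    linarith
  have hreg : ∀ {A : p → ℝ} {A' : q → ℝ},
      (∀ y : q → ℂ, ∑ i, A i * ‖(T *ᵥ y) i‖ ^ 2 ≤ ∑ j, A' j * ‖y j‖ ^ 2) →
      ∀ ε : ℝ, 0 < ε → ∀ y : q → ℂ, ∑ i, (A i + 1 * ε) * ‖(T *ᵥ y) i‖ ^ 2 ≤
        ∑ j, (A' j + C * ε) * ‖y j‖ ^ 2 := fun h ε hε y => by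
    simp only [add_mul, Finset.sum_add_distrib, ← Finset.mul_sum]
    nlinarith [h y, mul_le_mul_of_nonneg_left (hTC y) hε.le]
  refine le_of_tendsto_of_tendsto
    (tendsto_finsetSum _ fun i _ =>
      (hf.tendsto_perspective (hA i) (hB i) one_pos).mul_const _)
    (tendsto_finsetSum _ fun j _ =>
      (hf.tendsto_perspective (hA' j) (hB' j) hCpos).mul_const _)
    (eventually_mem_nhdsWithin.mono fun ε hε => ?_)
  have hε : 0 < ε := hε
  exact hf.sum_perspective_le_of_pos
    (fun i => add_pos_of_nonneg_of_pos (hA i) (by positivity))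
    (fun i => add_pos_of_nonneg_of_pos (hB i) (by positivity))
    (fun j => add_pos_of_nonneg_of_pos (hA' j) (by positivity))
    (fun j => add_pos_of_nonneg_of_pos (hB' j) (by positivity))
    (hreg hTA ε hε) (hreg hTB ε hε) y

end IsStandardOperatorMonotone

end QuadraticForms

/-! ### The skew information in an eigenbasis -/

section Diagonalization

variable {n : Type*} [Fintype n] [DecidableEq n]

lemma mem_spectrum_unitary_conj {U : Matrix n n ℂ} (hU : Uᴴ * U = 1) (d : n → ℝ) (i : n) :
    d i ∈ spectrum ℝ (U * realDiagonal d * Uᴴ) := by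
  by_contra h
  -- Otherwise the indicator function of `d i` would vanish on the spectrum.
  have h0 : cfc (fun x : ℝ => if x = d i then (1 : ℝ) else 0) (U * realDiagonal d * Uᴴ) = 0 := by
    rw [← cfc_zero ℝ (U * realDiagonal d * Uᴴ)]
    refine cfc_congr fun x hx => ?_
    have : x ≠ d i := fun e => h (e ▸ hx)
    simp [this]
  have hUU : U * Uᴴ = 1 := mul_eq_one_comm.mp hU
  rw [cfc_unitary_conj _ hU] at h0
  have h1 : Uᴴ * (U * realDiagonal (fun k => if d k = d i then (1 : ℝ) else 0) * Uᴴ) * U =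
      realDiagonal fun k => if d k = d i then (1 : ℝ) else 0 := by
    rw [← Matrix.mul_assoc, ← Matrix.mul_assoc, hU, Matrix.one_mul, Matrix.mul_assoc, hU,
      Matrix.mul_one]
  rw [h0, Matrix.mul_zero, Matrix.zero_mul] at h1
  simpa using congrFun (congrFun h1 i) i

/-- In an eigenbasis of `ρ`, the superoperator `g(L_ρ, R_ρ)` is an entrywise multiplication. -/
lemma leftRightCalculus_unitary_conj (g : ℝ → ℝ → ℝ) {U : Matrix n n ℂ} (hU : Uᴴ * U = 1)
    (d : n → ℝ) (X : Matrix n n ℂ) :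
    leftRightCalculus g (U * realDiagonal d * Uᴴ) X =
      U * Matrix.of (fun i j => (g (d i) (d j) : ℂ) * (Uᴴ * X * U) i j) * Uᴴ := by
  have hmem := mem_spectrum_unitary_conj hU d
  unfold leftRightCalculus spectralProjection
  simp only [cfc_unitary_conj _ hU]
  set S := (Matrix.finite_real_spectrum (A := U * realDiagonal d * Uᴴ)).toFinset with hS
  have hmem' : ∀ i, d i ∈ S := fun i => by simpa [hS] using hmem i
  have h1 : Matrix.of (fun i j => (g (d i) (d j) : ℂ) * (Uᴴ * X * U) i j) =
      ∑ a ∈ S, ∑ b ∈ S, g a b • (realDiagonal (fun i => if d i = a then (1 : ℝ) else 0) *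
        (Uᴴ * X * U) * realDiagonal fun i => if d i = b then (1 : ℝ) else 0) := by
    ext i j
    simp only [Matrix.sum_apply, Matrix.smul_apply, Matrix.mul_diagonal, Matrix.diagonal_mul]
    rw [Finset.sum_eq_single (d i), Finset.sum_eq_single (d j)]
    · simp
    · intro b _ hb
      simp [hb.symm]
    · exact fun h => absurd (hmem' j) h
    · intro a _ ha
      simp [ha.symm]
    · exact fun h => absurd (hmem' i) h
  rw [h1, Matrix.mul_sum, Matrix.sum_mul]
  refine Finset.sum_congr rfl fun a _ => ?_
  rw [Matrix.mul_sum, Matrix.sum_mul]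
  refine Finset.sum_congr rfl fun b _ => ?_
  simp only [Matrix.mul_smul, Matrix.smul_mul, Matrix.mul_assoc]

omit [DecidableEq n] in
lemma trace_conjTranspose_mul (X Y : Matrix n n ℂ) :
    (Xᴴ * Y).trace = ∑ i, ∑ j, star (X i j) * Y i j := by
  rw [Finset.sum_comm]
  rfl

/-- The Hilbert-Schmidt inner product is invariant under a unitary change of basis. -/
lemma trace_conjTranspose_mul_unitary {U : Matrix n n ℂ} (hU : Uᴴ * U = 1) (X Y : Matrix n n ℂ) :
    (Xᴴ * Y).trace = ∑ i, ∑ j, star ((Uᴴ * X * U) i j) * (Uᴴ * Y * U) i j := by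
  have hUU : U * Uᴴ = 1 := mul_eq_one_comm.mp hU
  rw [← trace_conjTranspose_mul]
  have : (Uᴴ * X * U)ᴴ * (Uᴴ * Y * U) = Uᴴ * (Xᴴ * Y * U) := by
    simp only [Matrix.conjTranspose_mul, Matrix.conjTranspose_conjTranspose, Matrix.mul_assoc]
    rw [← Matrix.mul_assoc U Uᴴ, hUU, Matrix.one_mul]
  rw [this, Matrix.trace_mul_comm Uᴴ, Matrix.mul_assoc _ U, hUU, Matrix.mul_one]

lemma re_star_mul_ofReal_mul_self (c : ℝ) (z : ℂ) : (star z * ((c : ℂ) * z)).re = c * ‖z‖ ^ 2 := by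
  have : star z * ((c : ℂ) * z) = ((c * ‖z‖ ^ 2 : ℝ) : ℂ) := by
    rw [Complex.ofReal_mul, Complex.ofReal_pow, ← Complex.conj_mul']
    simp only [RCLike.star_def]
    ring
  rw [this, Complex.ofReal_re]

/-- The quadratic form of left multiplication `L_ρ`, in an eigenbasis of `ρ`. -/
lemma re_trace_conjTranspose_mul_mul {U : Matrix n n ℂ} (hU : Uᴴ * U = 1) (d : n → ℝ)
    (Z : Matrix n n ℂ) :
    (Zᴴ * (U * realDiagonal d * Uᴴ) * Z).trace.re =
      ∑ i, ∑ j, d i * ‖(Uᴴ * Z * U) i j‖ ^ 2 := by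
  rw [Matrix.mul_assoc, trace_conjTranspose_mul_unitary hU]
  have : Uᴴ * (U * realDiagonal d * Uᴴ * Z) * U = realDiagonal d * (Uᴴ * Z * U) := by
    simp only [Matrix.mul_assoc]
    rw [← Matrix.mul_assoc Uᴴ U, hU, Matrix.one_mul]
  simp only [this, Matrix.diagonal_mul, Complex.re_sum, re_star_mul_ofReal_mul_self]

/-- The quadratic form of right multiplication `R_ρ`, in an eigenbasis of `ρ`. -/
lemma re_trace_mul_mul_conjTranspose {U : Matrix n n ℂ} (hU : Uᴴ * U = 1) (d : n → ℝ)
    (Z : Matrix n n ℂ) :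
    (Z * (U * realDiagonal d * Uᴴ) * Zᴴ).trace.re =
      ∑ i, ∑ j, d j * ‖(Uᴴ * Z * U) i j‖ ^ 2 := by
  have h := re_trace_conjTranspose_mul_mul hU d Zᴴ
  rw [Matrix.conjTranspose_conjTranspose] at h
  rw [h, Finset.sum_comm]
  refine Finset.sum_congr rfl fun i _ => Finset.sum_congr rfl fun j _ => ?_
  have : Uᴴ * Zᴴ * U = (Uᴴ * Z * U)ᴴ := by
    simp [Matrix.conjTranspose_mul, Matrix.mul_assoc]
  rw [this, Matrix.conjTranspose_apply, norm_star]

omit [DecidableEq n] in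
lemma isHermitian_I_smul_lie {H ρ : Matrix n n ℂ} (hH : H.IsHermitian) (hρ : ρ.IsHermitian) :
    (Complex.I • ⁅H, ρ⁆).IsHermitian := by
  unfold Matrix.IsHermitian
  rw [Matrix.conjTranspose_smul, Ring.lie_def, Matrix.conjTranspose_sub, Matrix.conjTranspose_mul,
    Matrix.conjTranspose_mul, hH.eq, hρ.eq]
  simp only [RCLike.star_def, Complex.conj_I, neg_smul, smul_sub]
  abel

/-- The skew information as a weighted sum over matrix entries in an eigenbasis of `ρ`. -/
lemma skewInformation_unitary_conj (f : ℝ → ℝ) {U : Matrix n n ℂ} (hU : Uᴴ * U = 1) (d : n → ℝ)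
    {H : Matrix n n ℂ} (hH : H.IsHermitian) :
    skewInformation f (U * realDiagonal d * Uᴴ) H =
      f 0 / 2 * ∑ i, ∑ j, morozovaChentsov f (d i) (d j) *
        ‖(Uᴴ * (Complex.I • ⁅H, U * realDiagonal d * Uᴴ⁆) * U) i j‖ ^ 2 := by
  unfold skewInformation
  rw [leftRightCalculus_unitary_conj _ hU]
  set X := Complex.I • ⁅H, U * realDiagonal d * Uᴴ⁆ with hX
  have hXh : Xᴴ = X := isHermitian_I_smul_lie hH (isHermitian_unitary_conj U d)
  congr 1
  conv_lhs => rw [← hXh, trace_conjTranspose_mul_unitary hU]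
  rw [hXh]
  have : ∀ G : Matrix n n ℂ, Uᴴ * (U * G * Uᴴ) * U = G := fun G => by
    rw [← Matrix.mul_assoc, ← Matrix.mul_assoc, hU, Matrix.one_mul, Matrix.mul_assoc, hU,
      Matrix.mul_one]
  simp only [this, Matrix.of_apply, Complex.re_sum, re_star_mul_ofReal_mul_self]

lemma unitary_conj_lie {U : Matrix n n ℂ} (hU : Uᴴ * U = 1) (d : n → ℝ) (H : Matrix n n ℂ)
    (i j : n) :
    (Uᴴ * ⁅H, U * realDiagonal d * Uᴴ⁆ * U) i j = ((d j : ℂ) - d i) * (Uᴴ * H * U) i j := by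
  have : Uᴴ * ⁅H, U * realDiagonal d * Uᴴ⁆ * U =
      (Uᴴ * H * U) * realDiagonal d - realDiagonal d * (Uᴴ * H * U) := by
    rw [Ring.lie_def, Matrix.mul_sub, Matrix.sub_mul]
    simp only [Matrix.mul_assoc]
    rw [hU, Matrix.mul_one, ← Matrix.mul_assoc Uᴴ U, hU, Matrix.one_mul]
  rw [this, Matrix.sub_apply, Matrix.mul_diagonal, Matrix.diagonal_mul]
  ring

lemma norm_sq_unitary_conj_I_smul_lie {U : Matrix n n ℂ} (hU : Uᴴ * U = 1) (d : n → ℝ)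
    (H : Matrix n n ℂ) (i j : n) :
    ‖(Uᴴ * (Complex.I • ⁅H, U * realDiagonal d * Uᴴ⁆) * U) i j‖ ^ 2 =
      (d i - d j) ^ 2 * ‖(Uᴴ * H * U) i j‖ ^ 2 := by
  rw [Matrix.mul_smul, Matrix.smul_mul, Matrix.smul_apply, unitary_conj_lie hU, norm_smul,
    Complex.norm_I, one_mul, norm_mul, mul_pow, ← Complex.ofReal_sub, Complex.norm_real,
    Real.norm_eq_abs, sq_abs]
  ring

end Diagonalization

/-! ### The Kadison-Schwarz inequality for a measurement -/

section Measurement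

variable {n J : Type*} [Fintype n] [DecidableEq n] [Fintype J]

omit [DecidableEq n] in
lemma trace_nonneg_of_posSemidef_conj {ρ : Matrix n n ℂ} (hρ : ρ.PosSemidef) (G : Matrix n n ℂ) :
    0 ≤ (G * ρ * Gᴴ).trace.re :=
  (Complex.nonneg_iff.1 (hρ.mul_mul_conjTranspose_same G).trace_nonneg).1

/-- A Kadison-Schwarz inequality `Z Zᴴ ≤ ∑ⱼ Eⱼᴴ Yⱼ Yⱼᴴ Eⱼ` for `Z = ∑ⱼ Eⱼᴴ Yⱼ Eⱼ`, integrated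
against a state: the difference is the sum of the squares of `Yⱼᴴ Eⱼ - Eⱼ Zᴴ`. -/
lemma IsMeasurement.re_trace_le {E : J → Matrix n n ℂ} (hE : IsMeasurement E) {ρ : Matrix n n ℂ}
    (hρ : ρ.PosSemidef) (Y : J → Matrix n n ℂ) :
    ((∑ j, (E j)ᴴ * Y j * E j)ᴴ * ρ * ∑ j, (E j)ᴴ * Y j * E j).trace.re ≤
      ∑ j, ((Y j)ᴴ * (E j * ρ * (E j)ᴴ) * Y j).trace.re := by
  set Z := ∑ j, (E j)ᴴ * Y j * E j with hZ
  have hnn := Finset.sum_nonneg fun j (_ : j ∈ Finset.univ) =>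
    trace_nonneg_of_posSemidef_conj hρ ((Y j)ᴴ * E j - E j * Zᴴ)
  have hexp : ∀ j, (((Y j)ᴴ * E j - E j * Zᴴ) * ρ * ((Y j)ᴴ * E j - E j * Zᴴ)ᴴ).trace =
      ((Y j)ᴴ * (E j * ρ * (E j)ᴴ) * Y j).trace - ((E j)ᴴ * (Y j)ᴴ * E j * (ρ * Z)).trace
        - ((Zᴴ * ρ) * ((E j)ᴴ * Y j * E j)).trace + (Zᴴ * ρ * Z * ((E j)ᴴ * E j)).trace := by
    intro j
    have e1 : ((E j)ᴴ * (Y j)ᴴ * E j * (ρ * Z)).trace =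
        ((Y j)ᴴ * E j * ρ * Z * (E j)ᴴ).trace := by
      rw [Matrix.trace_mul_comm _ (E j)ᴴ]; simp only [Matrix.mul_assoc]
    have e2 : ((Zᴴ * ρ) * ((E j)ᴴ * Y j * E j)).trace =
        (E j * Zᴴ * ρ * (E j)ᴴ * Y j).trace := by
      rw [← Matrix.mul_assoc, Matrix.trace_mul_comm _ (E j)]; simp only [Matrix.mul_assoc]
    have e3 : (Zᴴ * ρ * Z * ((E j)ᴴ * E j)).trace =
        (E j * Zᴴ * ρ * Z * (E j)ᴴ).trace := by
      rw [← Matrix.mul_assoc, Matrix.trace_mul_comm _ (E j)]; simp only [Matrix.mul_assoc]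
    rw [e1, e2, e3, ← Matrix.trace_sub, ← Matrix.trace_sub, ← Matrix.trace_add]
    congr 1
    simp only [Matrix.conjTranspose_sub, Matrix.conjTranspose_mul,
      Matrix.conjTranspose_conjTranspose, Matrix.mul_sub, Matrix.sub_mul, Matrix.mul_assoc]
    abel
  have hZh : Zᴴ = ∑ j, (E j)ᴴ * (Y j)ᴴ * E j := by
    simp [hZ, Matrix.conjTranspose_sum, Matrix.conjTranspose_mul, Matrix.mul_assoc]
  have s1 : ∑ j, ((E j)ᴴ * (Y j)ᴴ * E j * (ρ * Z)).trace = (Zᴴ * ρ * Z).trace := by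
    rw [← Matrix.trace_sum, ← Matrix.sum_mul, ← hZh, Matrix.mul_assoc]
  have s2 : ∑ j, ((Zᴴ * ρ) * ((E j)ᴴ * Y j * E j)).trace = (Zᴴ * ρ * Z).trace := by
    rw [← Matrix.trace_sum, ← Matrix.mul_sum]
  have s3 : ∑ j, (Zᴴ * ρ * Z * ((E j)ᴴ * E j)).trace = (Zᴴ * ρ * Z).trace := by
    rw [← Matrix.trace_sum, ← Matrix.mul_sum, hE, Matrix.mul_one]
  rw [← Complex.re_sum] at hnn ⊢
  simp only [hexp, Finset.sum_add_distrib, Finset.sum_sub_distrib, s1, s2, s3] at hnn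
  simp only [Complex.add_re, Complex.sub_re] at hnn
  linarith

end Measurement

/-! ### Monotonicity of the metric-adjusted skew information -/

section Monotonicity

namespace IsStandardOperatorMonotone

variable {f : ℝ → ℝ} (hf : IsStandardOperatorMonotone f)
include hf

lemma morozovaChentsov_pos (h0 : 0 < f 0) {x y : ℝ} (hx : 0 ≤ x) (hy : 0 ≤ y)
    (hxy : x ≠ y) : 0 < morozovaChentsov f x y := by
  unfold morozovaChentsov
  split_ifs with h
  · have : 0 < x := hx.lt_of_ne fun e => hxy (e ▸ h.symm)
    positivity
  · have hy : 0 < y := hy.lt_of_ne (Ne.symm h)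
    have : 0 < f (x * y⁻¹) := h0.trans_le (hf.monotoneOn (Set.mem_Ici.2 le_rfl)
      (Set.mem_Ici.2 (by positivity)) (by positivity))
    positivity

lemma perspective_nonneg {x y : ℝ} (hx : 0 ≤ x) (hy : 0 ≤ y) : 0 ≤ perspective f x y := by
  rcases hy.eq_or_lt with rfl | hy
  · rw [perspective_zero]
    exact mul_nonneg hx hf.nonneg_zero
  · rw [perspective_of_ne_zero f x hy.ne']
    exact mul_nonneg hy.le (hf.nonneg_zero.trans (hf.monotoneOn (Set.mem_Ici.2 le_rfl)
      (Set.mem_Ici.2 (by positivity)) (by positivity)))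

/-- The inequality behind the variational formula
`c |x|² = max_z (2 Re (x̄ z) - c⁻¹ |z|²)`. The hypothesis on `x` covers the edge case
`a = b = 0`, where the Morozova-Chentsov function is infinite and `morozovaChentsov` takes the
value `0`. -/
lemma two_mul_re_sub_le (h0 : 0 < f 0) {a b : ℝ} (ha : 0 ≤ a) (hb : 0 ≤ b) {x : ℂ}
    (hx : a = b → x = 0) (z : ℂ) :
    2 * (star x * z).re - perspective f a b * ‖z‖ ^ 2 ≤ morozovaChentsov f a b * ‖x‖ ^ 2 := by
  by_cases hab : a = b
  · have := mul_nonneg (hf.perspective_nonneg ha hb) (sq_nonneg ‖z‖)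
    simp [hx hab]
    exact this
  · have hc := hf.morozovaChentsov_pos h0 ha hb hab
    rw [perspective]
    set c := morozovaChentsov f a b
    have h1 : (star x * z).re ≤ ‖x‖ * ‖z‖ := by
      simpa using Complex.re_le_norm (star x * z)
    have h2 : c * ‖x‖ ^ 2 + c⁻¹ * ‖z‖ ^ 2 - 2 * (‖x‖ * ‖z‖) = c⁻¹ * (c * ‖x‖ - ‖z‖) ^ 2 := by
      field_simp
      ring
    have h3 : 0 ≤ c⁻¹ * (c * ‖x‖ - ‖z‖) ^ 2 := by positivity
    linarith

end IsStandardOperatorMonotone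

variable {n J K : Type*} [Fintype n] [DecidableEq n] [Fintype J] [Fintype K] [DecidableEq K]

/-- The unnormalized output of a measurement of which only the class `κ j` of the outcome `j` is
recorded, for the class `k`. -/
def coarseOutput (κ : J → K) (E : J → Matrix n n ℂ) (ρ : Matrix n n ℂ) (k : K) : Matrix n n ℂ :=
  ∑ j, if κ j = k then E j * ρ * (E j)ᴴ else 0

omit [DecidableEq n] [Fintype K] in
lemma coarseOutput_posSemidef (κ : J → K) (E : J → Matrix n n ℂ) {ρ : Matrix n n ℂ}
    (hρ : ρ.PosSemidef) (k : K) : (coarseOutput κ E ρ k).PosSemidef := by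
  refine Matrix.posSemidef_sum _ fun j _ => ?_
  split_ifs
  · exact hρ.mul_mul_conjTranspose_same _
  · exact .zero

omit [Fintype n] [DecidableEq n] in
lemma sum_coarse {M : Type*} [AddCommMonoid M] (κ : J → K) (g : J → K → M) :
    ∑ k, ∑ j, (if κ j = k then g j k else 0) = ∑ j, g j (κ j) := by
  rw [Finset.sum_comm]
  simp

/-- The operator means of `L_ρ` and `R_ρ` decrease under the dual `Y ↦ Z = ∑ⱼ Eⱼᴴ Y_{κ j} Eⱼ` of a
measurement, in eigenbases of `ρ` and of the output operators. -/
lemma IsStandardOperatorMonotone.sum_perspective_coarseOutput_le {f : ℝ → ℝ}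
    (hf : IsStandardOperatorMonotone f) (κ : J → K) {E : J → Matrix n n ℂ} (hE : IsMeasurement E)
    {U : Matrix n n ℂ} (hU : Uᴴ * U = 1) {d : n → ℝ} (hd : ∀ i, 0 ≤ d i)
    {V : K → Matrix n n ℂ} (hV : ∀ k, (V k)ᴴ * V k = 1) {e : K → n → ℝ} (he : ∀ k i, 0 ≤ e k i)
    (hout : ∀ k, coarseOutput κ E (U * realDiagonal d * Uᴴ) k =
      V k * realDiagonal (e k) * (V k)ᴴ) (y : K → Matrix n n ℂ) :
    ∑ i, ∑ j, perspective f (d i) (d j) *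
        ‖(Uᴴ * (∑ l, (E l)ᴴ * (V (κ l) * y (κ l) * (V (κ l))ᴴ) * E l) * U) i j‖ ^ 2 ≤
      ∑ k, ∑ i, ∑ j, perspective f (e k i) (e k j) * ‖y k i j‖ ^ 2 := by
  set ρ := U * realDiagonal d * Uᴴ with hρdef
  have hρ : ρ.PosSemidef := (Matrix.PosSemidef.diagonal fun i => by
    simpa using hd i).mul_mul_conjTranspose_same U
  -- The dual map, on matrix entries in the eigenbases.
  let toMat : (K × n × n → ℂ) → K → Matrix n n ℂ := fun w k => .of fun i j => w (k, i, j)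
  let Z : (K × n × n → ℂ) → Matrix n n ℂ := fun w =>
    ∑ l, (E l)ᴴ * (V (κ l) * toMat w (κ l) * (V (κ l))ᴴ) * E l
  let Φ : (K × n × n → ℂ) →ₗ[ℂ] (n × n → ℂ) :=
    { toFun := fun w x => (Uᴴ * Z w * U) x.1 x.2
      map_add' := fun w w' => by
        have : Z (w + w') = Z w + Z w' := by
          have : ∀ k, toMat (w + w') k = toMat w k + toMat w' k := fun k => rfl
          simp only [Z, this, Matrix.mul_add, Matrix.add_mul, Finset.sum_add_distrib]
        ext x
        simp [this, Matrix.mul_add, Matrix.add_mul]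
      map_smul' := fun c w => by
        have : Z (c • w) = c • Z w := by
          have : ∀ k, toMat (c • w) k = c • toMat w k := fun k => rfl
          simp only [Z, this, Matrix.mul_smul, Matrix.smul_mul, Finset.smul_sum]
        ext x
        simp [this] }
  have hΦ : ∀ w x, (LinearMap.toMatrix' Φ *ᵥ w) x = (Uᴴ * Z w * U) x.1 x.2 := fun w x => by
    rw [LinearMap.toMatrix'_mulVec]
    rfl
  have hVc : ∀ k (M : Matrix n n ℂ), (V k)ᴴ * (V k * M * (V k)ᴴ) * V k = M := fun k M => by
    rw [← Matrix.mul_assoc, ← Matrix.mul_assoc, hV, Matrix.one_mul, Matrix.mul_assoc, hV,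
      Matrix.mul_one]
  have hL : ∀ w : K × n × n → ℂ, ∑ x : n × n, d x.1 * ‖(LinearMap.toMatrix' Φ *ᵥ w) x‖ ^ 2 ≤
      ∑ x : K × n × n, e x.1 x.2.1 * ‖w x‖ ^ 2 := fun w => by
    have h := hE.re_trace_le hρ fun l => V (κ l) * toMat w (κ l) * (V (κ l))ᴴ
    rw [hρdef, re_trace_conjTranspose_mul_mul hU d] at h
    simp only [hΦ, Fintype.sum_prod_type]
    refine h.trans_eq ?_
    rw [← sum_coarse κ fun l k => ((V k * toMat w k * (V k)ᴴ)ᴴ *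
      (E l * (U * realDiagonal d * Uᴴ) * (E l)ᴴ) * (V k * toMat w k * (V k)ᴴ)).trace.re]
    refine Finset.sum_congr rfl fun k _ => ?_
    have h2 := re_trace_conjTranspose_mul_mul (hV k) (e k) (V k * toMat w k * (V k)ᴴ)
    rw [hVc, ← hout] at h2
    refine Eq.trans ?_ h2
    rw [coarseOutput, Matrix.mul_sum, Matrix.sum_mul, Matrix.trace_sum, Complex.re_sum]
    refine Finset.sum_congr rfl fun l _ => ?_
    split_ifs <;> simp [hρdef]
  have hR : ∀ w : K × n × n → ℂ, ∑ x : n × n, d x.2 * ‖(LinearMap.toMatrix' Φ *ᵥ w) x‖ ^ 2 ≤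
      ∑ x : K × n × n, e x.1 x.2.2 * ‖w x‖ ^ 2 := fun w => by
    have h := hE.re_trace_le hρ fun l => (V (κ l) * toMat w (κ l) * (V (κ l))ᴴ)ᴴ
    have hZ : ∑ l, (E l)ᴴ * (V (κ l) * toMat w (κ l) * (V (κ l))ᴴ)ᴴ * E l = (Z w)ᴴ := by
      simp only [Z, Matrix.conjTranspose_sum, Matrix.conjTranspose_mul,
        Matrix.conjTranspose_conjTranspose, Matrix.mul_assoc]
    rw [hZ] at h
    simp only [Matrix.conjTranspose_conjTranspose _] at h
    rw [hρdef, re_trace_mul_mul_conjTranspose hU d] at h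
    simp only [hΦ, Fintype.sum_prod_type]
    refine h.trans_eq ?_
    rw [← sum_coarse κ fun l k => ((V k * toMat w k * (V k)ᴴ) *
      (E l * (U * realDiagonal d * Uᴴ) * (E l)ᴴ) * (V k * toMat w k * (V k)ᴴ)ᴴ).trace.re]
    refine Finset.sum_congr rfl fun k _ => ?_
    have h2 := re_trace_mul_mul_conjTranspose (hV k) (e k) (V k * toMat w k * (V k)ᴴ)
    rw [hVc, ← hout] at h2
    refine Eq.trans ?_ h2
    rw [coarseOutput, Matrix.mul_sum, Matrix.sum_mul, Matrix.trace_sum, Complex.re_sum]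
    refine Finset.sum_congr rfl fun l _ => ?_
    split_ifs <;> simp [hρdef]
  have key := hf.sum_perspective_le (T := LinearMap.toMatrix' Φ) (fun x => hd x.1)
    (fun x => hd x.2) (fun x => he x.1 x.2.1) (fun x => he x.1 x.2.2) hL hR
    fun x => y x.1 x.2.1 x.2.2
  simp only [hΦ, Fintype.sum_prod_type] at key
  exact key

/-- The skew information does not increase, on average, under a measurement that commutes with `H`
and of which only the class `κ j` of the outcome is recorded: duality turns the monotonicity of the
operator means into that of the metric. -/
lemma IsStandardOperatorMonotone.sum_skewInformation_coarseOutput_le {f : ℝ → ℝ}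
    (hf : IsStandardOperatorMonotone f) (κ : J → K) {E : J → Matrix n n ℂ} (hE : IsMeasurement E)
    {H ρ : Matrix n n ℂ} (hH : H.IsHermitian) (hEH : ∀ j, ⁅E j, H⁆ = 0) (hρ : ρ.PosSemidef) :
    ∑ k, skewInformation f (coarseOutput κ E ρ k) H ≤ skewInformation f ρ H := by
  rcases hf.nonneg_zero.eq_or_lt with h0 | h0
  · simp [skewInformation, ← h0]
  obtain ⟨U, d, hU, hd, rfl⟩ := exists_unitary_conj hρ
  choose V e hV he hout using fun k => exists_unitary_conj (coarseOutput_posSemidef κ E hρ k)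
  set ρ := U * realDiagonal d * Uᴴ with hρdef
  have hinf : ∀ k, skewInformation f (coarseOutput κ E ρ k) H =
      f 0 / 2 * ∑ i, ∑ j, morozovaChentsov f (e k i) (e k j) *
        ‖((V k)ᴴ * (Complex.I • ⁅H, coarseOutput κ E ρ k⁆) * V k) i j‖ ^ 2 := fun k => by
    rw [hout k]
    exact skewInformation_unitary_conj f (hV k) (e k) hH
  simp only [hinf]
  rw [← Finset.mul_sum, hρdef, skewInformation_unitary_conj f hU d hH, ← hρdef]
  refine mul_le_mul_of_nonneg_left ?_ (by positivity)
  set x := Uᴴ * (Complex.I • ⁅H, ρ⁆) * U with hx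
  set X : K → Matrix n n ℂ := fun k => Complex.I • ⁅H, coarseOutput κ E ρ k⁆ with hX
  -- The maximizers `z = c_f x` in the variational formula for the outputs.
  set y : K → Matrix n n ℂ := fun k => .of fun i j =>
    (morozovaChentsov f (e k i) (e k j) : ℂ) * ((V k)ᴴ * X k * V k) i j with hy
  set Y : K → Matrix n n ℂ := fun k => V k * y k * (V k)ᴴ with hY
  set Z := ∑ l, (E l)ᴴ * Y (κ l) * E l with hZ
  have hmean := hf.sum_perspective_coarseOutput_le κ hE hU hd hV he (fun k => hout k) y
  have hval : ∀ k, ∑ i, ∑ j, morozovaChentsov f (e k i) (e k j) * ‖((V k)ᴴ * X k * V k) i j‖ ^ 2 =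
      ((X k)ᴴ * Y k).trace.re := fun k => by
    have hVc : (V k)ᴴ * Y k * V k = y k := by
      rw [hY, ← Matrix.mul_assoc, ← Matrix.mul_assoc, hV, Matrix.one_mul, Matrix.mul_assoc, hV,
        Matrix.mul_one]
    rw [trace_conjTranspose_mul_unitary (hV k), hVc]
    simp only [hy, Matrix.of_apply, Complex.re_sum, re_star_mul_ofReal_mul_self]
  have hval' : ∑ k, ∑ i, ∑ j, perspective f (e k i) (e k j) * ‖y k i j‖ ^ 2 =
      ∑ k, ∑ i, ∑ j, morozovaChentsov f (e k i) (e k j) * ‖((V k)ᴴ * X k * V k) i j‖ ^ 2 := by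
    refine Finset.sum_congr rfl fun k _ => Finset.sum_congr rfl fun i _ =>
      Finset.sum_congr rfl fun j _ => ?_
    simp only [hy, Matrix.of_apply, perspective, norm_mul, mul_pow, Complex.norm_real,
      Real.norm_eq_abs, sq_abs]
    rcases eq_or_ne (morozovaChentsov f (e k i) (e k j)) 0 with h | h
    · simp [h]
    · field_simp
  -- Covariance: since `Eⱼ` commutes with `H`, the measurement maps `i[H, ρ]` to `i[H, M(ρ)]`.
  have hpair : ∑ k, ((X k)ᴴ * Y k).trace.re =
      ((Complex.I • ⁅H, ρ⁆)ᴴ * Z).trace.re := by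
    have hX0 : (Complex.I • ⁅H, ρ⁆)ᴴ = Complex.I • ⁅H, ρ⁆ := isHermitian_I_smul_lie hH hρ.1
    have hXk : ∀ k, (X k)ᴴ = ∑ l, if κ l = k then
        E l * (Complex.I • ⁅H, ρ⁆) * (E l)ᴴ else 0 := fun k => by
      have : (X k)ᴴ = X k := isHermitian_I_smul_lie hH (coarseOutput_posSemidef κ E hρ k).1
      rw [this, hX]
      simp only [coarseOutput, Ring.lie_def, Matrix.mul_sum, Matrix.sum_mul,
        ← Finset.sum_sub_distrib, Finset.smul_sum]
      refine Finset.sum_congr rfl fun l _ => ?_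
      split_ifs
      · have c1 : E l * H = H * E l := sub_eq_zero.1 (hEH l)
        have c2 : H * (E l)ᴴ = (E l)ᴴ * H := by
          simpa [Matrix.conjTranspose_mul, hH.eq] using congrArg Matrix.conjTranspose c1
        rw [Matrix.mul_smul, Matrix.smul_mul, Matrix.mul_sub, Matrix.sub_mul]
        congr 2
        · simp only [← Matrix.mul_assoc, c1]
        · simp only [Matrix.mul_assoc, c2]
      · simp
    rw [← Complex.re_sum]
    congr 1
    rw [hX0, hZ, Matrix.mul_sum, Matrix.trace_sum]
    have : ∀ k, ((X k)ᴴ * Y k).trace = ∑ l, if κ l = k then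
        (E l * (Complex.I • ⁅H, ρ⁆) * (E l)ᴴ * Y k).trace else 0 := fun k => by
      rw [hXk, Matrix.sum_mul, Matrix.trace_sum]
      refine Finset.sum_congr rfl fun l _ => ?_
      split_ifs <;> simp
    simp only [this]
    rw [sum_coarse κ fun l k => (E l * (Complex.I • ⁅H, ρ⁆) * (E l)ᴴ * Y k).trace]
    refine Finset.sum_congr rfl fun l _ => ?_
    rw [Matrix.mul_assoc, Matrix.mul_assoc, Matrix.trace_mul_comm (E l)]
    simp only [Matrix.mul_assoc]
  have hbound : 2 * ((Complex.I • ⁅H, ρ⁆)ᴴ * Z).trace.re -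
      ∑ i, ∑ j, perspective f (d i) (d j) * ‖(Uᴴ * Z * U) i j‖ ^ 2 ≤
      ∑ i, ∑ j, morozovaChentsov f (d i) (d j) * ‖x i j‖ ^ 2 := by
    rw [trace_conjTranspose_mul_unitary hU, ← hx]
    simp only [Complex.re_sum, Finset.mul_sum, ← Finset.sum_sub_distrib]
    refine Finset.sum_le_sum fun i _ => Finset.sum_le_sum fun j _ => ?_
    refine hf.two_mul_re_sub_le h0 (hd i) (hd j) (fun hij => ?_) _
    have := norm_sq_unitary_conj_I_smul_lie hU d H i j
    rw [hij, sub_self, zero_pow two_ne_zero, zero_mul, ← hρdef, ← hx] at this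
    simpa using this
  have hsum : ∑ k, ∑ i, ∑ j, morozovaChentsov f (e k i) (e k j) *
      ‖((V k)ᴴ * X k * V k) i j‖ ^ 2 = ((Complex.I • ⁅H, ρ⁆)ᴴ * Z).trace.re := by
    rw [← hpair]
    exact Finset.sum_congr rfl fun k _ => hval k
  rw [hval', hsum] at hmean
  rw [hsum]
  linarith

lemma morozovaChentsov_mul (f : ℝ → ℝ) {t : ℝ} (ht : t ≠ 0) (x y : ℝ) :
    morozovaChentsov f (t * x) (t * y) = t⁻¹ * morozovaChentsov f x y := by
  unfold morozovaChentsov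
  by_cases hy : y = 0
  · simp [hy, mul_assoc, mul_comm]
  · have : t * x * (t * y)⁻¹ = x * y⁻¹ := by field_simp
    rw [if_neg hy, if_neg (mul_ne_zero ht hy), this, mul_assoc, mul_inv]

lemma skewInformation_zero (f : ℝ → ℝ) (H : Matrix n n ℂ) : skewInformation f 0 H = 0 := by
  simp [skewInformation, Ring.lie_def]

lemma skewInformation_smul (f : ℝ → ℝ) {t : ℝ} (ht : t ≠ 0) {H ρ : Matrix n n ℂ}
    (hH : H.IsHermitian) (hρ : ρ.PosSemidef) :
    skewInformation f (t • ρ) H = t * skewInformation f ρ H := by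
  obtain ⟨U, d, hU, -, rfl⟩ := exists_unitary_conj hρ
  have : t • (U * realDiagonal d * Uᴴ) = U * realDiagonal (fun i => t * d i) * Uᴴ := by
    rw [← Matrix.smul_mul, ← Matrix.mul_smul]
    congr 2
    ext i j
    rcases eq_or_ne i j with rfl | hij
    · simp
    · simp [hij]
  rw [this, skewInformation_unitary_conj f hU _ hH, skewInformation_unitary_conj f hU _ hH]
  simp only [norm_sq_unitary_conj_I_smul_lie hU, morozovaChentsov_mul f ht, Finset.mul_sum]
  refine Finset.sum_congr rfl fun i _ => Finset.sum_congr rfl fun j _ => ?_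
  field_simp

/-- Homogeneity of the skew information absorbs the normalization of the outcome states. -/
lemma outcomeProb_mul_skewInformation (f : ℝ → ℝ) (K : Matrix n n ℂ) {H ρ : Matrix n n ℂ}
    (hH : H.IsHermitian) (hρ : ρ.PosSemidef) :
    outcomeProb K ρ * skewInformation f (outcomeState K ρ) H =
      skewInformation f (K * ρ * Kᴴ) H := by
  have hK := hρ.mul_mul_conjTranspose_same K
  rw [outcomeState]
  rcases eq_or_ne (outcomeProb K ρ) 0 with h | h
  · have : K * ρ * Kᴴ = 0 := by
      refine hK.trace_eq_zero_iff.1 (Complex.ext h ?_)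
      exact (Complex.nonneg_iff.1 hK.trace_nonneg).2.symm
    rw [h, this, skewInformation_zero, zero_mul]
  · rw [skewInformation_smul f (inv_ne_zero h) hH hK, mul_inv_cancel_left₀ h]

omit [DecidableEq n] in
lemma measure_posSemidef (E : J → Matrix n n ℂ) {ρ : Matrix n n ℂ}
    (hρ : ρ.PosSemidef) : (measure E ρ).PosSemidef :=
  Matrix.posSemidef_sum _ fun _ _ => hρ.mul_mul_conjTranspose_same _

omit [DecidableEq n] in
lemma outcomeState_posSemidef (K : Matrix n n ℂ) {ρ : Matrix n n ℂ}
    (hρ : ρ.PosSemidef) : (outcomeState K ρ).PosSemidef :=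
  (hρ.mul_mul_conjTranspose_same K).smul (inv_nonneg.2 (trace_nonneg_of_posSemidef_conj hρ K))

namespace IsStandardOperatorMonotone

variable {f : ℝ → ℝ} (hf : IsStandardOperatorMonotone f)
include hf

lemma skewInformation_measure_le {E : J → Matrix n n ℂ} (hE : IsMeasurement E)
    {H ρ : Matrix n n ℂ} (hH : H.IsHermitian) (hEH : ∀ j, ⁅E j, H⁆ = 0) (hρ : ρ.PosSemidef) :
    skewInformation f (measure E ρ) H ≤ skewInformation f ρ H := by
  simpa [coarseOutput, measure] using
    hf.sum_skewInformation_coarseOutput_le (fun _ => ()) hE hH hEH hρ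

lemma sum_outcomeProb_mul_skewInformation_le {E : J → Matrix n n ℂ} (hE : IsMeasurement E)
    {H ρ : Matrix n n ℂ} (hH : H.IsHermitian) (hEH : ∀ j, ⁅E j, H⁆ = 0) (hρ : ρ.PosSemidef) :
    ∑ j, outcomeProb (E j) ρ * skewInformation f (outcomeState (E j) ρ) H ≤
      skewInformation f ρ H := by
  classical
  simpa [coarseOutput, outcomeProb_mul_skewInformation f _ hH hρ] using
    hf.sum_skewInformation_coarseOutput_le id hE hH hEH hρ

end IsStandardOperatorMonotone

end Monotonicity

/-! ### The Wigner-Yanase skew information -/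

section WignerYanase

/-- The standard operator monotone function `((1 + √x) / 2)²` of the Wigner-Yanase metric. -/
noncomputable def wignerYanaseFunction (x : ℝ) : ℝ :=
  ((1 + √x) / 2) ^ 2

lemma wignerYanaseFunction_zero : wignerYanaseFunction 0 = 1 / 4 := by
  norm_num [wignerYanaseFunction]

lemma morozovaChentsov_wignerYanaseFunction_mul {x y : ℝ} (hx : 0 ≤ x) (hy : 0 ≤ y) :
    morozovaChentsov wignerYanaseFunction x y * (x - y) ^ 2 = 4 * (√x - √y) ^ 2 := by
  unfold morozovaChentsov
  rcases hy.eq_or_lt with rfl | hy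
  · rw [if_pos rfl, wignerYanaseFunction_zero, Real.sqrt_zero, sub_zero, sub_zero, Real.sq_sqrt hx]
    rcases eq_or_ne x 0 with rfl | hx0
    · simp
    · field_simp
  · obtain ⟨r, hr, rfl⟩ : ∃ r, 0 ≤ r ∧ x = r ^ 2 :=
      ⟨√x, Real.sqrt_nonneg x, (Real.sq_sqrt hx).symm⟩
    obtain ⟨s, hs, rfl⟩ : ∃ s, 0 < s ∧ y = s ^ 2 :=
      ⟨√y, Real.sqrt_pos.2 hy, (Real.sq_sqrt hy.le).symm⟩
    rw [if_neg hy.ne', wignerYanaseFunction, ← div_eq_mul_inv, ← div_pow,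
      Real.sqrt_sq (by positivity), Real.sqrt_sq hr, Real.sqrt_sq hs.le]
    have : s + r ≠ 0 := by positivity
    field_simp
    ring

variable {n : Type*} [Fintype n] [DecidableEq n]

open scoped MatrixOrder Matrix.Norms.L2Operator in
/-- Operator monotonicity of the square root, which holds in every C⋆-algebra; the L2 operator norm
makes the matrices one. -/
lemma cfc_sqrt_sub_posSemidef {A B : Matrix n n ℂ} (hA : A.PosSemidef)
    (hAB : (B - A).PosSemidef) : (cfc Real.sqrt B - cfc Real.sqrt A).PosSemidef := by
  have hB : B.PosSemidef := by simpa using hAB.add hA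
  have h := CFC.sqrt_le_sqrt A B (Matrix.le_iff.2 hAB)
  rw [CFC.sqrt_eq_real_sqrt A hA.nonneg, CFC.sqrt_eq_real_sqrt B hB.nonneg,
    cfcₙ_eq_cfc, cfcₙ_eq_cfc] at h
  exact Matrix.le_iff.1 h

lemma isStandardOperatorMonotone_wignerYanaseFunction :
    IsStandardOperatorMonotone wignerYanaseFunction where
  operator_monotone k A B hA hAB := by
    have hB : B.PosSemidef := by simpa using hAB.add hA
    have key : ∀ {C : Matrix (Fin k) (Fin k) ℂ}, C.PosSemidef → cfc wignerYanaseFunction C =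
        (1 / 4 : ℝ) • ((1 : Matrix (Fin k) (Fin k) ℂ) + (2 : ℝ) • cfc Real.sqrt C + C) := by
      intro C hC
      obtain ⟨U, d, hU, hd, rfl⟩ := exists_unitary_conj hC
      have h1 : (1 : Matrix (Fin k) (Fin k) ℂ) = U * realDiagonal (fun _ => 1) * Uᴴ := by
        simp [realDiagonal, mul_eq_one_comm.mp hU]
      conv_rhs => rw [h1]
      rw [cfc_unitary_conj _ hU, cfc_unitary_conj _ hU, ← Matrix.smul_mul, ← Matrix.mul_smul,
        ← Matrix.add_mul, ← Matrix.add_mul, ← Matrix.mul_add, ← Matrix.mul_add, ← Matrix.smul_mul,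
        ← Matrix.mul_smul]
      congr 2
      ext i j
      rcases eq_or_ne i j with rfl | hij
      · have : wignerYanaseFunction (d i) = 1 / 4 * (1 + 2 * √(d i) + d i) := by
          unfold wignerYanaseFunction
          nlinarith [Real.sq_sqrt (hd i)]
        simp [this, mul_add]
      · simp [hij]
    rw [key hA, key hB, ← smul_sub]
    refine Matrix.PosSemidef.smul ?_ (by norm_num)
    have h := ((cfc_sqrt_sub_posSemidef hA hAB).smul (zero_le_two (α := ℝ))).add hAB
    convert h using 1
    module
  symmetric x hx := by
    have hs := Real.sqrt_pos.2 hx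
    have h2 := Real.sq_sqrt hx.le
    unfold wignerYanaseFunction
    rw [Real.sqrt_div' _ hx.le, Real.sqrt_one]
    nth_rw 2 [← h2]
    field_simp
    ring
  normalized := by norm_num [wignerYanaseFunction]
  continuous_zero := by
    unfold wignerYanaseFunction
    fun_prop

/-- The Wigner-Yanase skew information is the skew information of `((1 + √x) / 2)²`: both are
`∑ (√λᵢ - √λⱼ)² |Hᵢⱼ|² / 2` in an eigenbasis of `ρ`. -/
lemma wignerYanase_eq_skewInformation {H ρ : Matrix n n ℂ} (hH : H.IsHermitian)
    (hρ : ρ.PosSemidef) :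
    wignerYanase ρ H = skewInformation wignerYanaseFunction ρ H := by
  obtain ⟨U, d, hU, hd, rfl⟩ := exists_unitary_conj hρ
  rw [skewInformation_unitary_conj _ hU _ hH, wignerYanase, cfc_unitary_conj _ hU]
  have hsq : ∀ R : Matrix n n ℂ, R.IsHermitian → ⁅R, H⁆ ^ 2 = -(⁅H, R⁆ᴴ * ⁅H, R⁆) := by
    intro R hR
    rw [Ring.lie_def, Ring.lie_def, Matrix.conjTranspose_sub, Matrix.conjTranspose_mul,
      Matrix.conjTranspose_mul, hH.eq, hR.eq]
    noncomm_ring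
  rw [hsq _ (isHermitian_unitary_conj U _), Matrix.trace_neg, trace_conjTranspose_mul_unitary hU,
    wignerYanaseFunction_zero, Complex.neg_re, neg_mul_neg]
  simp only [Complex.re_sum, Finset.mul_sum]
  refine Finset.sum_congr rfl fun i _ => Finset.sum_congr rfl fun j _ => ?_
  have hre := re_star_mul_ofReal_mul_self 1
  simp only [Complex.ofReal_one, one_mul] at hre
  rw [hre, norm_sq_unitary_conj_I_smul_lie hU, unitary_conj_lie hU, norm_mul, mul_pow,
    ← Complex.ofReal_sub, Complex.norm_real, Real.norm_eq_abs, sq_abs]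
  linear_combination (-(1 / 8) * ‖(Uᴴ * H * U) i j‖ ^ 2) *
    morozovaChentsov_wignerYanaseFunction_mul (hd i) (hd j)

end WignerYanase

end SkewInformation

open SkewInformation in
theorem mainTheorem4 {n J : Type*} [Fintype n] [DecidableEq n] [Fintype J]
    (H ρ : Matrix n n ℂ) (hH : H.IsHermitian) (hρ : SkewInformation.IsState ρ)
    (E : J → Matrix n n ℂ) (hE : SkewInformation.IsMeasurement E)
    (hEH : ∀ j, ⁅E j, H⁆ = 0) :
    (∀ f : ℝ → ℝ, SkewInformation.IsStandardOperatorMonotone f →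
      SkewInformation.skewInformation f (SkewInformation.measure E ρ) H
          ≤ SkewInformation.skewInformation f ρ H ∧
      ∑ j, SkewInformation.outcomeProb (E j) ρ *
            SkewInformation.skewInformation f (SkewInformation.outcomeState (E j) ρ) H
          ≤ SkewInformation.skewInformation f ρ H) ∧
    SkewInformation.wignerYanase (SkewInformation.measure E ρ) H
        ≤ SkewInformation.wignerYanase ρ H ∧
    ∑ j, SkewInformation.outcomeProb (E j) ρ *
          SkewInformation.wignerYanase (SkewInformation.outcomeState (E j) ρ) H
        ≤ SkewInformation.wignerYanase ρ H := by
  have hf := isStandardOperatorMonotone_wignerYanaseFunction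
  refine ⟨fun f hf => ⟨hf.skewInformation_measure_le hE hH hEH hρ.1,
    hf.sum_outcomeProb_mul_skewInformation_le hE hH hEH hρ.1⟩, ?_, ?_⟩
  · rw [wignerYanase_eq_skewInformation hH hρ.1,
      wignerYanase_eq_skewInformation hH (measure_posSemidef E hρ.1)]
    exact hf.skewInformation_measure_le hE hH hEH hρ.1
  · rw [wignerYanase_eq_skewInformation hH hρ.1]
    simp only [wignerYanase_eq_skewInformation hH (outcomeState_posSemidef _ hρ.1)]
    exact hf.sum_outcomeProb_mul_skewInformation_le hE hH hEH hρ.1
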